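/- For $\alpha>0$ and $1\le p<\infty$ let $F^p_\alpha$ be the Fock space of entire functions $f:\mathbb C\to\mathbb C$ with $$\|f\|_{p,\alpha}^p=\frac{\alpha p}{2\pi}\int_{\mathbb C}\bigl|f(z)e^{-\frac{\alpha}{2}|z|^2}\bigr|^p\,dA(z)<\infty ,$$ where $dA$ is Lebesgue area measure, normed by $\|\cdot\|_{p,\alpha}$. **Theorem.** Let $1<p<\infty$, $\alpha>0$, and let $\mu$ be a positive Borel measure on $(0,\infty)$ such that $$\mu\bigl((0,1)\bigr)=0\qquad\text{and}\qquad \sup_{n\ge 0}\int_{[1,\infty)}\frac{1}{t^{n+1}}\,d\mu(t)<\infty .$$ Then the Hausdorff operator $$\mathcal H_\mu(f)(z)=\int_{(0,\infty)}\frac1t\,f\!\left(\frac zt\right)d\mu(t),\qquad z\in\mathbb C,$$ is well defined on $F^p_\alpha$ (the integral converges absolutely for all $f\in F^p_\alpha$ and $z\in\mathbb C$) and is a bounded linear operator from $F^p_\alpha$ to $F^p_\alpha$. It is compact on $F^p_\alpha$ (that is, the image of the unit ball is relatively compact in norm) if and only if $$\lim_{n\to\infty}\int_{[1,\infty)}\frac{1}{t^{n+1}}\,d\mu(t)=0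 .$$ -/

import Mathlib

open MeasureTheory Set Filter Topology
open scoped ENNReal

noncomputable section

/-- The function `z ↦ f(z) e^{-α|z|²/2}`. -/
def fockMul (α : ℝ) (f : ℂ → ℂ) (z : ℂ) : ℂ :=
  f z * (Real.exp (-(α / 2) * ‖z‖ ^ 2) : ℂ)

/-- `f` is an entire function with `∫_ℂ |f(z) e^{-α|z|²/2}|^p dA(z) < ∞`
(for entire `f` the integrand is continuous and nonnegative, so integrability is finiteness of
the integral). -/
def IsFock (p α : ℝ) (f : ℂ → ℂ) : Prop :=
  Differentiable ℂ f ∧ Integrable (fun z : ℂ => ‖fockMul α f z‖ ^ p) volume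

/-- `((α p / 2π) ∫_ℂ |f(z) e^{-α|z|²/2}|^p dA(z))^{1/p}`. -/
def fockNorm (p α : ℝ) (f : ℂ → ℂ) : ℝ :=
  (α * p / (2 * Real.pi) * ∫ z : ℂ, ‖fockMul α f z‖ ^ p) ^ (1 / p)

theorem fockMul_continuous {α : ℝ} {f : ℂ → ℂ} (hf : Differentiable ℂ f) :
    Continuous (fockMul α f) := by
  have := hf.continuous
  unfold fockMul
  fun_prop

theorem isFock_iff_memLp {p α : ℝ} (hp : 1 ≤ p) {f : ℂ → ℂ} :
    IsFock p α f ↔ Differentiable ℂ f ∧ MemLp (fockMul α f) (ENNReal.ofReal p) volume := by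
  unfold IsFock
  refine and_congr_right fun hf => ?_
  have h := integrable_norm_rpow_iff (μ := (volume : Measure ℂ)) (p := ENNReal.ofReal p)
    (fockMul_continuous (α := α) hf).aestronglyMeasurable
    (by simp; linarith) ENNReal.ofReal_ne_top
  rw [ENNReal.toReal_ofReal (by linarith)] at h
  exact h

/-- Up to the constant `(α p / 2π)^{1/p}`, the Fock norm is an `L^p` norm. -/
theorem fockNorm_eq {p α : ℝ} (hp : 1 ≤ p) (hα : 0 < α) {f : ℂ → ℂ} (hf : IsFock p α f) :
    fockNorm p α f = (α * p / (2 * Real.pi)) ^ (1 / p) *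
      (eLpNorm (fockMul α f) (ENNReal.ofReal p) volume).toReal := by
  have hL := ((isFock_iff_memLp hp).1 hf).2
  have h0 : 0 ≤ ∫ z : ℂ, ‖fockMul α f z‖ ^ p :=
    integral_nonneg fun z => Real.rpow_nonneg (norm_nonneg _) _
  rw [hL.eLpNorm_eq_integral_rpow_norm (by simp; linarith) ENNReal.ofReal_ne_top,
    ENNReal.toReal_ofReal (show (0 : ℝ) ≤ p by linarith),
    ENNReal.toReal_ofReal (Real.rpow_nonneg h0 _)]
  unfold fockNorm
  rw [Real.mul_rpow (by positivity) h0, one_div]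

theorem fockMul_add (α : ℝ) (f g : ℂ → ℂ) : fockMul α (f + g) = fockMul α f + fockMul α g := by
  ext z; simp [fockMul, add_mul]

theorem fockMul_smul (α : ℝ) (c : ℂ) (f : ℂ → ℂ) : fockMul α (c • f) = c • fockMul α f := by
  ext z; simp [fockMul, mul_assoc]

/-- The Fock space as a linear space of functions. -/
def fockSubmodule (p α : ℝ) [hp : Fact (1 ≤ p)] : Submodule ℂ (ℂ → ℂ) where
  carrier := {f | IsFock p α f}
  add_mem' := by
    intro f g hf hg
    have hf' := (isFock_iff_memLp hp.out).1 hf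
    have hg' := (isFock_iff_memLp hp.out).1 hg
    refine (isFock_iff_memLp hp.out).2 ⟨hf'.1.add hg'.1, ?_⟩
    rw [fockMul_add]
    exact hf'.2.add hg'.2
  zero_mem' := by
    refine (isFock_iff_memLp hp.out).2 ⟨differentiable_const 0, ?_⟩
    have : fockMul α 0 = 0 := by ext z; simp [fockMul]
    rw [this]
    exact MemLp.zero
  smul_mem' := by
    intro c f hf
    have hf' := (isFock_iff_memLp hp.out).1 hf
    refine (isFock_iff_memLp hp.out).2 ⟨hf'.1.const_smul c, ?_⟩
    rw [fockMul_smul]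
    exact hf'.2.const_smul c

/-- The Fock space `F^p_α`, `1 ≤ p < ∞`, `α > 0`. It is a type of its own, so that its topology is
the one of the norm `fockNorm` and not the topology of pointwise convergence. -/
def FockSpace (p α : ℝ) [Fact (1 ≤ p)] : Type := fockSubmodule p α

namespace FockSpace

variable {p α : ℝ} [hp : Fact (1 ≤ p)]

instance : AddCommGroup (FockSpace p α) := inferInstanceAs (AddCommGroup (fockSubmodule p α))

instance : Module ℂ (FockSpace p α) := inferInstanceAs (Module ℂ (fockSubmodule p α))

instance : CoeFun (FockSpace p α) (fun _ => ℂ → ℂ) := ⟨fun f => f.1⟩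

theorem isFock (f : FockSpace p α) : IsFock p α f := f.2

theorem coe_add (f g : FockSpace p α) : ((f + g : FockSpace p α) : ℂ → ℂ) = f.1 + g.1 := rfl

theorem coe_smul (c : ℂ) (f : FockSpace p α) : ((c • f : FockSpace p α) : ℂ → ℂ) = c • f.1 := rfl

theorem coe_neg (f : FockSpace p α) : ((-f : FockSpace p α) : ℂ → ℂ) = -f.1 := rfl

theorem coe_zero : ((0 : FockSpace p α) : ℂ → ℂ) = 0 := rfl

theorem coe_injective {f g : FockSpace p α} (h : f.1 = g.1) : f = g := Subtype.ext h

theorem norm_smul_aux [hα : Fact (0 < α)] (c : ℂ) (f : FockSpace p α) :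
    fockNorm p α (c • f : FockSpace p α) = ‖c‖ * fockNorm p α f := by
  rw [fockNorm_eq hp.out hα.out (isFock _), fockNorm_eq hp.out hα.out (isFock f), coe_smul,
    fockMul_smul, eLpNorm_const_smul, ENNReal.toReal_mul]
  simp
  ring

instance instNormedAddCommGroup [hα : Fact (0 < α)] : NormedAddCommGroup (FockSpace p α) :=
  AddGroupNorm.toNormedAddCommGroup
    { toFun := fun f => fockNorm p α f
      map_zero' := by
        have h := norm_smul_aux (0 : ℂ) (0 : FockSpace p α)
        simpa using h
      add_le' := by
        intro f g
        have hf := (isFock_iff_memLp hp.out).1 (isFock f)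
        have hg := (isFock_iff_memLp hp.out).1 (isFock g)
        rw [fockNorm_eq hp.out hα.out (isFock _), fockNorm_eq hp.out hα.out (isFock f),
          fockNorm_eq hp.out hα.out (isFock g), coe_add, fockMul_add, ← mul_add,
          ← ENNReal.toReal_add hf.2.eLpNorm_ne_top hg.2.eLpNorm_ne_top]
        have hp0 := hp.out
        have hα0 := hα.out
        refine mul_le_mul_of_nonneg_left ?_ (by positivity)
        exact ENNReal.toReal_mono
          (ENNReal.add_ne_top.2 ⟨hf.2.eLpNorm_ne_top, hg.2.eLpNorm_ne_top⟩)
          (eLpNorm_add_le hf.2.1 hg.2.1 (by simpa using hp.out))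
      neg' := by
        intro f
        have h := norm_smul_aux (-1 : ℂ) f
        simpa using h
      eq_zero_of_map_eq_zero' := by
        intro f h
        have hp0 := hp.out
        have hα0 := hα.out
        have hf := (isFock_iff_memLp hp.out).1 (isFock f)
        change fockNorm p α f = 0 at h
        rw [fockNorm_eq hp.out hα.out (isFock f)] at h
        have h1 : (eLpNorm (fockMul α f) (ENNReal.ofReal p) volume).toReal = 0 :=
          (mul_eq_zero.1 h).resolve_left (by positivity)
        have h2 := (ENNReal.toReal_eq_zero_iff _).1 h1
        have h3 := h2.resolve_right hf.2.eLpNorm_ne_top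
        rw [eLpNorm_eq_zero_iff hf.2.1 (by simp; linarith)] at h3
        have h4 := Continuous.ae_eq_iff_eq volume (fockMul_continuous hf.1) continuous_zero |>.1 h3
        apply coe_injective
        ext z
        have h5 := congrFun h4 z
        simp only [fockMul, Pi.zero_apply, mul_eq_zero, Complex.ofReal_eq_zero,
          Real.exp_ne_zero, or_false] at h5
        exact h5 }

theorem norm_def [Fact (0 < α)] (f : FockSpace p α) : ‖f‖ = fockNorm p α f := rfl

instance instNormedSpace [Fact (0 < α)] : NormedSpace ℂ (FockSpace p α) where
  norm_smul_le c f := (norm_smul_aux c f).le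

end FockSpace

/-- The Hausdorff operator `H_μ(f)(z) = ∫_{(0,∞)} (1/t) f(z/t) dμ(t)`. Only the restriction of `μ`
to `(0,∞)` matters. -/
def hausdorffOp (μ : Measure ℝ) (f : ℂ → ℂ) (z : ℂ) : ℂ :=
  ∫ t in Ioi (0 : ℝ), (1 / (t : ℂ)) * f (z / (t : ℂ)) ∂μ

/-- The moment `∫_{[1,∞)} t^{-(n+1)} dμ(t)`, as an element of `[0,∞]`. -/
def hausdorffMoment (μ : Measure ℝ) (n : ℕ) : ℝ≥0∞ :=
  ∫⁻ t in Ici (1 : ℝ), ENNReal.ofReal (1 / t ^ (n + 1)) ∂μ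

end

/-! Since `μ` is carried by `[1, ∞)`, termwise integration of the Taylor series shows that the
operator multiplies the n-th Taylor coefficient by the moment m_n = ∫ t^{-(n+1)} dμ
(`hasSum_moment_mul_taylorTerm`). These moments decrease to μ({1}), and an atom at 1 contributes a
multiple of the identity; so the criterion says that compactness is the absence of this atom.

Two norm bounds carry the proof. Passing to the n-th Taylor term is a contraction, because by
Cauchy's formula it is an average of rotations (`eLpNorm_fockMul_taylorTerm_le`). An average of
dilations by t in [1, 2] has norm at most 4 times the mass (`eLpNorm_fockMul_integral_dilation_le`).

Cut the measure at some s in (1, 2] (`exists_decomposition`). The part t ≥ s has moments O(s^{-n}),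
hence is a norm-convergent series of rank-one operators and compact; the part t < s has norm at most
4 μ([1, s)). One cut gives boundedness. Without an atom at 1, letting s → 1 exhibits the operator as
a norm limit of compact ones. Conversely, if all m_n ≥ c > 0, the images of the normalized monomials
are c-separated (`not_isCompactOperator_of_le`). -/

/-! ### Norms of averages -/

/-- A weak form of Minkowski's integral inequality: the `L^p` seminorm of an average of functions
is controlled by a uniform bound on their `L^p` seminorms. -/
theorem eLpNorm_integral_le_of_forall_le {X Y E : Type*} [MeasurableSpace X] [MeasurableSpace Y]
    [NormedAddCommGroup E] [NormedSpace ℝ E]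
    {ν : Measure X} [IsFiniteMeasure ν] {ρ : Measure Y} [SFinite ρ] {p : ℝ} (hp : 1 ≤ p)
    {F : X → Y → E} (hF : AEStronglyMeasurable (Function.uncurry F) (ν.prod ρ)) {B : ℝ≥0∞}
    (hB : ∀ᵐ x ∂ν, eLpNorm (F x) (ENNReal.ofReal p) ρ ≤ B) :
    eLpNorm (fun y => ∫ x, F x y ∂ν) (ENNReal.ofReal p) ρ ≤ ν univ * B := by
  have hp0 : 0 < p := by linarith
  have hq0 : ENNReal.ofReal p ≠ 0 := by simpa using hp0
  have hB' : ∀ᵐ x ∂ν, ∫⁻ y, ‖F x y‖ₑ ^ p ∂ρ ≤ B ^ p := by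
    filter_upwards [hB] with x hx
    rw [eLpNorm_eq_lintegral_rpow_enorm_toReal hq0 ENNReal.ofReal_ne_top,
      ENNReal.toReal_ofReal hp0.le] at hx
    exact by
      rw [one_div] at hx
      exact (ENNReal.rpow_inv_le_iff hp0).1 hx
  rw [eLpNorm_eq_lintegral_rpow_enorm_toReal hq0 ENNReal.ofReal_ne_top,
    ENNReal.toReal_ofReal hp0.le, one_div, ENNReal.rpow_inv_le_iff hp0]
  have hmeas : AEMeasurable (fun z : Y × X => ‖F z.2 z.1‖ₑ ^ p) (ρ.prod ν) :=
    (hF.prod_swap.enorm).pow_const p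
  -- Hölder against the constant 1 on the finite measure `ν`; Tonelli then exchanges the integrals.
  have hpt : ∀ᵐ y ∂ρ, (∫⁻ x, ‖F x y‖ₑ ∂ν) ^ p ≤ ν univ ^ (p - 1) * ∫⁻ x, ‖F x y‖ₑ ^ p ∂ν := by
    filter_upwards [hF.prod_swap.prodMk_left] with y hy
    have h := eLpNorm_le_eLpNorm_mul_rpow_measure_univ (μ := ν) (p := 1) (q := ENNReal.ofReal p)
      (by simpa using hp) hy
    rw [eLpNorm_one_eq_lintegral_enorm, eLpNorm_eq_lintegral_rpow_enorm_toReal hq0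
      ENNReal.ofReal_ne_top, ENNReal.toReal_ofReal hp0.le] at h
    have h2 := ENNReal.rpow_le_rpow h hp0.le
    rw [ENNReal.mul_rpow_of_nonneg _ _ hp0.le, ← ENNReal.rpow_mul, ← ENNReal.rpow_mul,
      one_div_mul_cancel hp0.ne', ENNReal.rpow_one] at h2
    have h3 : (1 / ENNReal.toReal 1 - 1 / p) * p = p - 1 := by
      rw [ENNReal.toReal_one]; field_simp
    rw [h3, mul_comm] at h2
    exact h2
  calc ∫⁻ y, ‖∫ x, F x y ∂ν‖ₑ ^ p ∂ρ
      ≤ ∫⁻ y, ν univ ^ (p - 1) * ∫⁻ x, ‖F x y‖ₑ ^ p ∂ν ∂ρ := by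
        refine lintegral_mono_ae (hpt.mono fun y hy => ?_)
        exact (ENNReal.rpow_le_rpow (enorm_integral_le_lintegral_enorm _) hp0.le).trans hy
    _ = ν univ ^ (p - 1) * ∫⁻ x, ∫⁻ y, ‖F x y‖ₑ ^ p ∂ρ ∂ν := by
        rw [lintegral_const_mul'' _ hmeas.lintegral_prod_right', lintegral_lintegral_swap hmeas]
    _ ≤ ν univ ^ (p - 1) * ∫⁻ _, B ^ p ∂ν := by
        gcongr 1
        exact lintegral_mono_ae hB'
    _ = (ν univ * B) ^ p := by
        rw [lintegral_const, ENNReal.mul_rpow_of_nonneg _ _ hp0.le, mul_comm (B ^ p), ← mul_assoc]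
        congr 1
        -- Adding exponents requires a nonzero base, so zero mass is treated apart.
        rcases eq_or_ne (ν univ) 0 with h0 | h0
        · simp [h0, ENNReal.zero_rpow_of_pos hp0]
        · nth_rewrite 2 [← ENNReal.rpow_one (ν univ)]
          rw [← ENNReal.rpow_add _ _ h0 (measure_ne_top _ _), sub_add_cancel]

/-! ### Taylor coefficients and the Fock norm -/

/-- The `n`-th Taylor coefficient of `f` at the origin. -/
noncomputable def taylorCoeff (n : ℕ) (f : ℂ → ℂ) : ℂ := (n.factorial : ℂ)⁻¹ * iteratedDeriv n f 0

theorem hasSum_taylorCoeff {f : ℂ → ℂ} (hf : Differentiable ℂ f) (z : ℂ) :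
    HasSum (fun n => taylorCoeff n f * z ^ n) (f z) := by
  refine (Complex.hasSum_taylorSeries_of_entire hf 0 z).congr_fun ?_
  intro n
  simp only [taylorCoeff, sub_zero, smul_eq_mul]
  ring

theorem taylorCoeff_add (n : ℕ) {f g : ℂ → ℂ} (hf : Differentiable ℂ f)
    (hg : Differentiable ℂ g) : taylorCoeff n (f + g) = taylorCoeff n f + taylorCoeff n g := by
  rw [taylorCoeff, iteratedDeriv_add hf.contDiff.contDiffAt hg.contDiff.contDiffAt, mul_add]
  rfl

theorem taylorCoeff_smul (n : ℕ) (c : ℂ) {f : ℂ → ℂ} (hf : Differentiable ℂ f) :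
    taylorCoeff n (c • f) = c * taylorCoeff n f := by
  rw [taylorCoeff, iteratedDeriv_const_smul hf.contDiff.contDiffAt c, smul_eq_mul, taylorCoeff]
  ring

theorem taylorCoeff_pow (n m : ℕ) : taylorCoeff n (fun z => z ^ m) = if n = m then 1 else 0 := by
  rw [taylorCoeff, iteratedDeriv_fun_pow_zero]
  split_ifs with h
  · subst h
    exact inv_mul_cancel₀ (by exact_mod_cast n.factorial_ne_zero)
  · simp

/-- Cauchy's formula for the Taylor coefficients on a circle. -/
theorem taylorCoeff_mul_pow_eq_integral {f : ℂ → ℂ} (hf : Differentiable ℂ f) (n : ℕ) (z : ℂ) :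
    taylorCoeff n f * z ^ n = ∫ θ in Ioc 0 (2 * Real.pi),
      (2 * Real.pi : ℂ)⁻¹ * Complex.exp (-(n * θ * Complex.I)) *
        f (z * Complex.exp (θ * Complex.I)) := by
  -- For fixed `z`, the n-th coefficient of w ↦ f(zw) is already a_n z^n, so the unit circle serves
  -- for every `z`, including 0.
  have hg : Differentiable ℂ fun w => f (z * w) := by fun_prop
  have h := (hg.diffContOnCl (s := Metric.ball (0 : ℂ) 1)).circleIntegral_one_div_sub_center_pow_smul
    one_pos n
  rw [iteratedDeriv_comp_const_mul hf.contDiff] at h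
  have hn : (n.factorial : ℂ) ≠ 0 := by exact_mod_cast n.factorial_ne_zero
  have hpi : (Real.pi : ℂ) ≠ 0 := by exact_mod_cast Real.pi_ne_zero
  rw [← intervalIntegral.integral_of_le Real.two_pi_pos.le]
  have h2 : (∮ w in C(0, 1), (1 / (w - 0) ^ (n + 1)) • f (z * w)) = (2 * Real.pi * Complex.I) *
      ∫ θ in (0 : ℝ)..2 * Real.pi, (2 * Real.pi : ℂ)⁻¹ * Complex.exp (-(n * θ * Complex.I)) *
        f (z * Complex.exp (θ * Complex.I)) := by
    rw [circleIntegral, ← intervalIntegral.integral_const_mul]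
    refine intervalIntegral.integral_congr fun θ _ => ?_
    have he := Complex.exp_ne_zero (θ * Complex.I)
    simp only [deriv_circleMap, circleMap, smul_eq_mul, Complex.ofReal_one, one_mul, zero_add,
      sub_zero, Complex.exp_neg, mul_assoc (n : ℂ), Complex.exp_nat_mul]
    field_simp
    ring
  rw [h2] at h
  have hI := Complex.I_ne_zero
  simp only [mul_zero, smul_eq_mul] at h
  have h3 : (2 * Real.pi * Complex.I : ℂ) ≠ 0 := by simp [hpi]
  apply mul_left_cancel₀ h3
  rw [h, taylorCoeff]
  field_simp

theorem norm_fockMul (α : ℝ) (f : ℂ → ℂ) (z : ℂ) :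
    ‖fockMul α f z‖ = ‖f z‖ * Real.exp (-(α / 2) * ‖z‖ ^ 2) := by
  rw [fockMul, norm_mul, Complex.norm_real, Real.norm_of_nonneg (Real.exp_pos _).le]

/-- The Taylor terms of `f` have smaller Fock norm than `f`. -/
theorem eLpNorm_fockMul_taylorTerm_le {p α : ℝ} (hp : 1 ≤ p) {f : ℂ → ℂ}
    (hf : Differentiable ℂ f) (n : ℕ) :
    eLpNorm (fockMul α fun z => taylorCoeff n f * z ^ n) (ENNReal.ofReal p) volume ≤
      eLpNorm (fockMul α f) (ENNReal.ofReal p) volume := by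
  -- Rotations preserve |z|, so the Gaussian weight can be moved inside the integral; the factor
  -- 1/(2π) will cancel the length of the interval.
  let F : ℝ → ℂ → ℂ := fun θ z => (2 * Real.pi : ℂ)⁻¹ * Complex.exp (-(n * θ * Complex.I)) *
    fockMul α f (z * Complex.exp (θ * Complex.I))
  have hFc : Continuous (Function.uncurry F) := by
    simp only [F, Function.uncurry_def]
    have := fockMul_continuous (α := α) hf
    fun_prop
  have hnorm : ∀ θ : ℝ, ‖Complex.exp (θ * Complex.I)‖ = 1 := fun θ => by
    rw [Complex.norm_exp_ofReal_mul_I]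
  have hnorm' : ∀ θ : ℝ, ‖Complex.exp (-(n * θ * Complex.I))‖ = 1 := fun θ => by
    rw [Complex.norm_exp]; simp
  have hpi : ‖(2 * Real.pi : ℂ)⁻¹‖ₑ = ENNReal.ofReal (2 * Real.pi)⁻¹ := by
    rw [← ofReal_norm, norm_inv, norm_mul, Complex.norm_real, Real.norm_of_nonneg Real.pi_pos.le,
      Complex.norm_ofNat]
  have hB : ∀ θ, eLpNorm (F θ) (ENNReal.ofReal p) volume ≤
      ENNReal.ofReal (2 * Real.pi)⁻¹ * eLpNorm (fockMul α f) (ENNReal.ofReal p) volume := by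
    intro θ
    have h1 : eLpNorm (F θ) (ENNReal.ofReal p) volume = eLpNorm ((2 * Real.pi : ℂ)⁻¹ •
        (fockMul α f ∘ rotation (Circle.exp θ))) (ENNReal.ofReal p) volume := by
      refine eLpNorm_congr_norm_ae (ae_of_all _ fun z => ?_)
      simp [F, hnorm', mul_comm z]
    rw [h1, eLpNorm_const_smul, hpi, eLpNorm_comp_measurePreserving
      (fockMul_continuous hf).aestronglyMeasurable (LinearIsometryEquiv.measurePreserving _)]
  have hmain := eLpNorm_integral_le_of_forall_le
    (ν := volume.restrict (Ioc (0 : ℝ) (2 * Real.pi))) (ρ := (volume : Measure ℂ)) hp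
    hFc.aestronglyMeasurable (ae_of_all _ hB)
  have heq : (fun z => ∫ θ, F θ z ∂volume.restrict (Ioc (0 : ℝ) (2 * Real.pi))) =
      fockMul α fun z => taylorCoeff n f * z ^ n := by
    funext z
    rw [fockMul, taylorCoeff_mul_pow_eq_integral hf, ← integral_mul_const]
    refine integral_congr_ae (ae_of_all _ fun θ => ?_)
    simp only [F, fockMul, norm_mul, hnorm, mul_one, mul_assoc]
  rw [heq] at hmain
  refine hmain.trans_eq ?_
  rw [Measure.restrict_apply_univ, Real.volume_Ioc, sub_zero, ← mul_assoc,
    ← ENNReal.ofReal_mul Real.two_pi_pos.le, mul_inv_cancel₀ Real.two_pi_pos.ne',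
    ENNReal.ofReal_one, one_mul]

theorem isFock_pow {p α : ℝ} (hp : 1 ≤ p) (hα : 0 < α) (n : ℕ) :
    IsFock p α fun z => z ^ n := by
  refine ⟨by fun_prop, ?_⟩
  have hb : 0 < p * (α / 2) := by positivity
  have hq : (-2 : ℝ) < n * p := by
    have : 0 ≤ (n : ℝ) * p := by positivity
    linarith
  have h := Complex.integral_rpow_mul_exp_neg_mul_rpow (p := 2) one_le_two hq hb
  have hpos : 0 < Real.Gamma ((n * p + 2) / 2) := Real.Gamma_pos_of_pos (by linarith)
  have hint : Integrable fun z : ℂ => ‖z‖ ^ (n * p) * Real.exp (-(p * (α / 2)) * ‖z‖ ^ (2 : ℝ)) := by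
    -- A non-integrable function has integral 0 by convention, but the Gamma formula gives a
    -- positive value.
    by_contra hcon
    rw [integral_undef hcon] at h
    have : 0 < (2 * Real.pi / 2) * (p * (α / 2)) ^ (-(n * p + 2) / 2) *
      Real.Gamma ((n * p + 2) / 2) := by positivity
    linarith
  refine hint.congr (ae_of_all _ fun z => ?_)
  simp only [norm_fockMul, norm_pow]
  rw [Real.mul_rpow (by positivity) (by positivity), ← Real.rpow_natCast ‖z‖ n, ← Real.rpow_mul
    (norm_nonneg _), ← Real.exp_mul, Real.rpow_two]
  ring_nf

/-! ### Monomials, Taylor projections and point evaluations -/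

namespace FockSpace

variable {p α : ℝ} [hp : Fact (1 ≤ p)]

theorem memLp (f : FockSpace p α) : MemLp (fockMul α f) (ENNReal.ofReal p) volume :=
  ((isFock_iff_memLp hp.out).1 f.isFock).2

theorem differentiable (f : FockSpace p α) : Differentiable ℂ f.1 := f.isFock.1

/-- The element of the Fock space given by an entire function of finite `L^p` seminorm. -/
def mk (f : ℂ → ℂ) (hf : Differentiable ℂ f)
    (h : eLpNorm (fockMul α f) (ENNReal.ofReal p) volume < ∞) : FockSpace p α :=
  ⟨f, (isFock_iff_memLp hp.out).2
    ⟨hf, (fockMul_continuous hf).aestronglyMeasurable, h⟩⟩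

/-- The monomial `z ↦ z ^ n`. -/
def monomial [hα : Fact (0 < α)] (n : ℕ) : FockSpace p α :=
  ⟨fun z => z ^ n, isFock_pow hp.out hα.out n⟩

variable [hα : Fact (0 < α)]

theorem const_pos (p α : ℝ) [hp : Fact (1 ≤ p)] [hα : Fact (0 < α)] :
    0 < (α * p / (2 * Real.pi)) ^ (1 / p) := by
  have := hα.out
  have := hp.out
  positivity

theorem norm_eq (f : FockSpace p α) : ‖f‖ = (α * p / (2 * Real.pi)) ^ (1 / p) *
    (eLpNorm (fockMul α f) (ENNReal.ofReal p) volume).toReal :=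
  fockNorm_eq hp.out hα.out f.isFock

theorem norm_le_mul_norm {f g : FockSpace p α} {C : ℝ} (hC : 0 ≤ C)
    (h : eLpNorm (fockMul α g) (ENNReal.ofReal p) volume ≤
      ENNReal.ofReal C * eLpNorm (fockMul α f) (ENNReal.ofReal p) volume) : ‖g‖ ≤ C * ‖f‖ := by
  have h1 := ENNReal.toReal_mono (ENNReal.mul_ne_top ENNReal.ofReal_ne_top
    f.memLp.eLpNorm_ne_top) h
  rw [ENNReal.toReal_mul, ENNReal.toReal_ofReal hC] at h1
  rw [norm_eq, norm_eq, mul_left_comm]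
  exact mul_le_mul_of_nonneg_left h1 (const_pos p α).le

theorem monomial_apply (n : ℕ) (z : ℂ) : (monomial n : FockSpace p α) z = z ^ n := rfl

theorem monomial_norm_pos (n : ℕ) : 0 < ‖(monomial n : FockSpace p α)‖ := by
  rw [norm_pos_iff]
  intro h
  have h1 : (monomial n : FockSpace p α) 1 = (0 : FockSpace p α) 1 := by rw [h]
  rw [monomial_apply, coe_zero, one_pow] at h1
  exact one_ne_zero h1

theorem taylorCoeff_monomial (n m : ℕ) :
    taylorCoeff n (monomial m : FockSpace p α) = if n = m then 1 else 0 := taylorCoeff_pow n m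

/-- The Cauchy estimate of the Fock space: it makes the Taylor projections contractions and the
coefficient functionals bounded. -/
theorem norm_taylorCoeff_mul_norm_monomial_le (f : FockSpace p α) (n : ℕ) :
    ‖taylorCoeff n f‖ * ‖(monomial n : FockSpace p α)‖ ≤ ‖f‖ := by
  rw [← norm_smul, ← one_mul ‖f‖]
  refine norm_le_mul_norm zero_le_one ?_
  rw [ENNReal.ofReal_one, one_mul]
  exact eLpNorm_fockMul_taylorTerm_le hp.out f.differentiable n

/-- The projection of a function to its `n`-th Taylor term. -/
noncomputable def taylorProj (n : ℕ) : FockSpace p α →L[ℂ] FockSpace p α :=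
  LinearMap.mkContinuous
    { toFun := fun f => taylorCoeff n f • monomial n
      map_add' := fun f g => by
        rw [coe_add, taylorCoeff_add n f.differentiable g.differentiable, add_smul]
      map_smul' := fun c f => by
        rw [coe_smul, taylorCoeff_smul n c f.differentiable, mul_smul, RingHom.id_apply] }
    1 fun f => by
      rw [one_mul, LinearMap.coe_mk, AddHom.coe_mk, norm_smul]
      exact norm_taylorCoeff_mul_norm_monomial_le f n

theorem taylorProj_apply (n : ℕ) (f : FockSpace p α) :
    taylorProj n f = taylorCoeff n f • (monomial n : FockSpace p α) := rfl

theorem taylorProj_norm_le (n : ℕ) : ‖(taylorProj n : FockSpace p α →L[ℂ] FockSpace p α)‖ ≤ 1 :=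
  LinearMap.mkContinuous_norm_le _ zero_le_one _

/-- The projection has rank one: it factors through `ℂ` by the bounded coefficient functional. -/
theorem isCompactOperator_taylorProj (n : ℕ) :
    IsCompactOperator (taylorProj n : FockSpace p α →L[ℂ] FockSpace p α) := by
  let φ : FockSpace p α →L[ℂ] ℂ := LinearMap.mkContinuous
    { toFun := fun f => taylorCoeff n f
      map_add' := fun f g => by
        rw [coe_add, taylorCoeff_add n f.differentiable g.differentiable]
      map_smul' := fun c f => by
        rw [coe_smul, taylorCoeff_smul n c f.differentiable]; rfl }
    ‖(monomial n : FockSpace p α)‖⁻¹ fun f => by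
      rw [← div_eq_inv_mul, le_div_iff₀ (monomial_norm_pos n)]
      exact norm_taylorCoeff_mul_norm_monomial_le f n
  have h : IsCompactOperator φ :=
    isCompactOperator_of_locallyCompactSpace_dom φ
  exact h.clm_comp (ContinuousLinearMap.toSpanSingleton ℂ (monomial n : FockSpace p α))

/-- The norms of the monomials grow faster than any geometric progression. -/
theorem exists_mul_pow_le_norm_monomial {R : ℝ} (hR : 0 ≤ R) :
    ∃ c > 0, ∀ n, c * R ^ n ≤ ‖(monomial n : FockSpace p α)‖ := by
  -- Outside the disc of radius `R` one has |z|^n ≥ R^n, so the norm of the Gaussian restricted to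
  -- this set supplies `c`.
  let s : Set ℂ := {z | R < ‖z‖}
  have hs : IsOpen s := isOpen_lt continuous_const continuous_norm
  have hsne : s.Nonempty := ⟨((R + 1 : ℝ) : ℂ), by
    simp only [s, mem_ofPred_eq, Complex.norm_real, Real.norm_eq_abs]
    exact lt_of_lt_of_le (by linarith) (le_abs_self _)⟩
  let g : ℂ → ℂ := s.indicator (fockMul α fun _ => 1)
  have hgle : ∀ (n : ℕ) (z : ℂ), R ^ n * ‖g z‖ ≤ ‖fockMul α (fun z => z ^ n) z‖ := by
    intro n z
    by_cases hz : z ∈ s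
    · rw [show g z = fockMul α (fun _ => 1) z from indicator_of_mem hz _, norm_fockMul,
        norm_fockMul, norm_one, one_mul, norm_pow]
      gcongr
      exact (show R < ‖z‖ from hz).le
    · rw [show g z = 0 from indicator_of_notMem hz _]
      simp
  have hgm : AEStronglyMeasurable g volume :=
    (fockMul_continuous (differentiable_const 1)).aestronglyMeasurable.indicator hs.measurableSet
  have hg1 : ∀ n : ℕ, ENNReal.ofReal (R ^ n) * eLpNorm g (ENNReal.ofReal p) volume ≤
      eLpNorm (fockMul α (monomial n : FockSpace p α)) (ENNReal.ofReal p) volume := by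
    intro n
    have h := eLpNorm_mono (p := ENNReal.ofReal p) (μ := volume)
      (f := ((R ^ n : ℝ) : ℂ) • g) (g := fockMul α (fun z => z ^ n)) fun z => by
        have := hgle n z
        simpa [abs_of_nonneg hR] using this
    rw [eLpNorm_const_smul, ← ofReal_norm, Complex.norm_real, Real.norm_of_nonneg (by positivity)]
      at h
    exact h
  have hg0 : eLpNorm g (ENNReal.ofReal p) volume ≠ 0 := by
    rw [Ne, eLpNorm_eq_zero_iff hgm (by simpa using lt_of_lt_of_le one_pos hp.out)]
    intro h
    refine (hs.measure_pos volume hsne).ne' (measure_mono_null (fun z hz => ?_) h)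
    change ¬ g z = 0
    rw [show g z = fockMul α (fun _ => 1) z from indicator_of_mem hz _, fockMul]
    simp
  have hgtop : eLpNorm g (ENNReal.ofReal p) volume ≠ ∞ := by
    have := hg1 0
    rw [pow_zero, ENNReal.ofReal_one, one_mul] at this
    exact ne_top_of_le_ne_top (memLp _).eLpNorm_ne_top this
  refine ⟨(α * p / (2 * Real.pi)) ^ (1 / p) * (eLpNorm g (ENNReal.ofReal p) volume).toReal,
    mul_pos (const_pos p α) (ENNReal.toReal_pos hg0 hgtop), fun n => ?_⟩
  rw [norm_eq, mul_assoc]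
  refine mul_le_mul_of_nonneg_left ?_ (const_pos p α).le
  have h := ENNReal.toReal_mono (memLp _).eLpNorm_ne_top (hg1 n)
  rwa [ENNReal.toReal_mul, ENNReal.toReal_ofReal (by positivity), mul_comm] at h

/-- Point evaluations are bounded, uniformly on compact sets. -/
theorem exists_norm_apply_le {R : ℝ} (hR : 0 < R) :
    ∃ C > 0, ∀ (f : FockSpace p α) (z : ℂ), ‖z‖ ≤ R → ‖f z‖ ≤ C * ‖f‖ := by
  -- Growth at radius `2 * R` makes the Taylor series on |z| ≤ R a geometric one with ratio 1/2.
  obtain ⟨c, hc, hcn⟩ := exists_mul_pow_le_norm_monomial (p := p) (α := α) (R := 2 * R)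
    (by positivity)
  refine ⟨c⁻¹ * 2, by positivity, fun f z hz => ?_⟩
  have hterm : ∀ n, ‖taylorCoeff n f * z ^ n‖ ≤ c⁻¹ * ‖f‖ * (1 / 2) ^ n := by
    intro n
    have h1 : ‖taylorCoeff n f‖ * (c * (2 * R) ^ n) ≤ ‖f‖ :=
      (mul_le_mul_of_nonneg_left (hcn n) (norm_nonneg _)).trans
        (norm_taylorCoeff_mul_norm_monomial_le f n)
    rw [norm_mul, norm_pow]
    calc ‖taylorCoeff n f‖ * ‖z‖ ^ n ≤ ‖taylorCoeff n f‖ * R ^ n := by gcongr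
      _ = c⁻¹ * (‖taylorCoeff n f‖ * (c * (2 * R) ^ n)) * (1 / 2) ^ n := by
        rw [mul_pow, one_div, inv_pow]; field_simp
      _ ≤ c⁻¹ * ‖f‖ * (1 / 2) ^ n := by gcongr
  have hsum := hasSum_taylorCoeff f.differentiable z
  rw [← hsum.tsum_eq]
  refine (tsum_of_norm_bounded (hasSum_geometric_two.mul_left (c⁻¹ * ‖f‖)) hterm).trans_eq ?_
  ring

/-- Point evaluation as a bounded functional. -/
noncomputable def evalCLM (z : ℂ) : FockSpace p α →L[ℂ] ℂ :=
  LinearMap.mkContinuousOfExistsBound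
    { toFun := fun f => f z
      map_add' := fun _ _ => rfl
      map_smul' := fun _ _ => rfl }
    (by
      obtain ⟨C, _, h⟩ := exists_norm_apply_le (p := p) (α := α) (R := ‖z‖ + 1) (by positivity)
      exact ⟨C, fun f => h f z (by linarith)⟩)

end FockSpace

/-! ### Completeness -/

namespace FockSpace

variable {p α : ℝ} [hp : Fact (1 ≤ p)] [hα : Fact (0 < α)]

theorem eLpNorm_eq (f : FockSpace p α) : eLpNorm (fockMul α f) (ENNReal.ofReal p) volume =
    ENNReal.ofReal (‖f‖ / (α * p / (2 * Real.pi)) ^ (1 / p)) := by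
  rw [norm_eq, mul_div_cancel_left₀ _ (const_pos p α).ne',
    ENNReal.ofReal_toReal f.memLp.eLpNorm_ne_top]

/-- A Cauchy sequence converges uniformly on discs by the evaluation bounds, so its limit is entire;
Fatou's lemma turns this into norm convergence. Completeness is what sums series of operators and
keeps norm limits of compact operators compact. -/
instance instCompleteSpace : CompleteSpace (FockSpace p α) := by
  refine Metric.complete_of_cauchySeq_tendsto fun u hu => ?_
  have hlim : ∀ z, ∃ w, Tendsto (fun n => u n z) atTop (𝓝 w) := fun z =>
    cauchySeq_tendsto_of_complete (hu.map (evalCLM z).uniformContinuous)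
  choose g hg using hlim
  have hunif : ∀ R > 0, TendstoUniformlyOn (fun n z => u n z) g atTop (Metric.ball 0 R) := by
    intro R hR
    obtain ⟨C, hC, hCb⟩ := exists_norm_apply_le (p := p) (α := α) hR
    refine UniformCauchySeqOn.tendstoUniformlyOn_of_tendsto ?_ fun z _ => hg z
    rw [Metric.uniformCauchySeqOn_iff]
    intro ε hε
    obtain ⟨N, hN⟩ := Metric.cauchySeq_iff.1 hu (ε / C) (by positivity)
    refine ⟨N, fun m hm n hn z hz => ?_⟩
    have h := hCb (u m - u n) z (mem_ball_zero_iff.1 hz).le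
    rw [dist_eq_norm]
    refine lt_of_le_of_lt h ?_
    rw [mul_comm, ← lt_div_iff₀ hC, ← dist_eq_norm]
    exact hN m hm n hn
  have hgd : Differentiable ℂ g := by
    intro z
    have h := (hunif (‖z‖ + 1) (by positivity)).tendstoLocallyUniformlyOn.differentiableOn
      (Eventually.of_forall fun n => (u n).differentiable.differentiableOn) Metric.isOpen_ball
    exact h.differentiableAt (Metric.isOpen_ball.mem_nhds (by simp))
  have hbound : ∀ ε > 0, ∃ N, ∀ n ≥ N,
      eLpNorm (fockMul α (g - (u n).1)) (ENNReal.ofReal p) volume ≤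
        ENNReal.ofReal (ε / (α * p / (2 * Real.pi)) ^ (1 / p)) := by
    intro ε hε
    obtain ⟨N, hN⟩ := Metric.cauchySeq_iff.1 hu ε hε
    refine ⟨N, fun n hn => ?_⟩
    refine (Lp.eLpNorm_lim_le_liminf_eLpNorm (f := fun m => fockMul α (u m - u n : FockSpace p α))
      (fun m => (memLp _).1) _ (ae_of_all _ fun z => ?_)).trans ?_
    · exact ((hg z).sub_const _).mul_const _
    · refine (liminf_le_liminf (v := fun _ => _) ?_).trans (liminf_const _).le
      filter_upwards [eventually_ge_atTop N] with m hm
      rw [eLpNorm_eq, ← dist_eq_norm]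
      have := (const_pos p α).le
      gcongr
      exact (hN m hm n hn).le
  -- Any finite bound would do: it puts g - u_N in the space, hence also g.
  obtain ⟨N, hN⟩ := hbound 1 one_pos
  let G : FockSpace p α := mk (g - (u N).1) (hgd.sub (u N).differentiable)
    ((hN N le_rfl).trans_lt ENNReal.ofReal_lt_top) + u N
  have hG : ∀ z, G z = g z := fun z => sub_add_cancel (g z) (u N z)
  refine ⟨G, Metric.tendsto_atTop.2 fun ε hε => ?_⟩
  obtain ⟨M, hM⟩ := hbound (ε / 2) (by positivity)
  refine ⟨M, fun n hn => ?_⟩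
  have h := hM n hn
  have h1 : g - (u n).1 = (G - u n : FockSpace p α).1 := by
    funext z
    exact congrArg (· - u n z) (hG z).symm
  rw [h1, eLpNorm_eq, ENNReal.ofReal_le_ofReal_iff (div_nonneg (by positivity) (const_pos p α).le),
    div_le_div_iff_of_pos_right (const_pos p α)] at h
  rw [dist_comm, dist_eq_norm]
  linarith

end FockSpace

/-! ### Averages of dilations -/

/-- Dilation by a factor in `[1, 2]` is bounded in the Fock norm. -/
theorem eLpNorm_fockMul_dilation_le {p α : ℝ} (hp : 1 ≤ p) (hα : 0 < α) {f : ℂ → ℂ}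
    (hf : Differentiable ℂ f) {t : ℝ} (h1 : 1 ≤ t) (h2 : t ≤ 2) :
    eLpNorm (fockMul α fun z => (1 / (t : ℂ)) * f (z / t)) (ENNReal.ofReal p) volume ≤
      4 * eLpNorm (fockMul α f) (ENNReal.ofReal p) volume := by
  have ht0 : 0 < t := by linarith
  -- For t ≥ 1 the factor 1/t is at most 1, and the Gaussian at `z` is at most the one at z/t.
  have hle : ∀ z : ℂ, ‖fockMul α (fun z => (1 / (t : ℂ)) * f (z / t)) z‖ ≤
      ‖(fockMul α f ∘ (t⁻¹ • · : ℂ → ℂ)) z‖ := by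
    intro z
    have hz : t⁻¹ • z = z / t := by
      rw [Complex.real_smul, Complex.ofReal_inv, div_eq_inv_mul]
    rw [Function.comp_apply, hz, norm_fockMul, norm_fockMul, norm_mul, norm_div, norm_div, norm_one,
      Complex.norm_real, Real.norm_of_nonneg ht0.le]
    have h3 : 1 / t ≤ 1 := by rw [div_le_one ht0]; exact h1
    have h4 : ‖z‖ / t ≤ ‖z‖ := div_le_self (norm_nonneg _) h1
    have h5 : -(α / 2) * ‖z‖ ^ 2 ≤ -(α / 2) * (‖z‖ / t) ^ 2 := by
      rw [neg_mul, neg_mul, neg_le_neg_iff]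
      gcongr
    calc 1 / t * ‖f (z / t)‖ * Real.exp (-(α / 2) * ‖z‖ ^ 2)
        ≤ 1 * ‖f (z / t)‖ * Real.exp (-(α / 2) * (‖z‖ / t) ^ 2) := by gcongr
      _ = _ := by rw [one_mul]
  refine (eLpNorm_mono hle).trans ?_
  rw [← eLpNorm_map_measure (fockMul_continuous hf).aestronglyMeasurable (by fun_prop),
    Measure.map_addHaar_smul _ (by positivity), eLpNorm_smul_measure_of_ne_top ENNReal.ofReal_ne_top,
    smul_eq_mul]
  gcongr
  -- The change of variables costs t^{2/p} ≤ t² ≤ 4.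
  have h6 : |((t⁻¹) ^ Module.finrank ℝ ℂ)⁻¹| = t ^ 2 := by
    rw [Complex.finrank_real_complex, inv_pow, inv_inv, abs_of_nonneg (by positivity)]
  have h7 : (1 / ENNReal.ofReal p).toReal = 1 / p := by
    rw [one_div, ENNReal.toReal_inv, ENNReal.toReal_ofReal (by linarith), one_div]
  rw [h6, h7, ENNReal.ofReal_rpow_of_pos (by positivity)]
  refine (ENNReal.ofReal_le_ofReal (q := 4) ?_).trans_eq (by norm_num)
  calc (t ^ 2) ^ (1 / p) ≤ (t ^ 2) ^ (1 : ℝ) :=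
        Real.rpow_le_rpow_of_exponent_le (one_le_pow₀ h1) (by rw [div_le_one (by linarith)]; exact hp)
    _ = t ^ 2 := Real.rpow_one _
    _ ≤ 2 ^ 2 := by gcongr
    _ = 4 := by norm_num

theorem integrable_one_div_mul_comp_div {ν : Measure ℝ} (h1 : ∀ᵐ t ∂ν, 1 ≤ t)
    (hν : Integrable (fun t : ℝ => 1 / t) ν) {f : ℂ → ℂ} (hf : Continuous f) (z : ℂ) :
    Integrable (fun t : ℝ => (1 / (t : ℂ)) * f (z / t)) ν := by
  obtain ⟨C, hC⟩ := (isCompact_closedBall (0 : ℂ) ‖z‖).exists_bound_of_continuousOn hf.continuousOn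
  have hm : Measurable fun t : ℝ => (1 / (t : ℂ)) * f (z / t) :=
    (measurable_const.div Complex.measurable_ofReal).mul
      (hf.measurable.comp (measurable_const.div Complex.measurable_ofReal))
  refine (hν.mul_const C).mono' hm.aestronglyMeasurable ?_
  filter_upwards [h1] with t ht
  have ht0 : 0 < t := by linarith
  rw [norm_mul, norm_div, norm_one, Complex.norm_real, Real.norm_of_nonneg ht0.le]
  gcongr
  refine hC _ ?_
  rw [mem_closedBall_zero_iff, norm_div, Complex.norm_real, Real.norm_of_nonneg ht0.le]
  exact div_le_self (norm_nonneg _) ht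

theorem integrable_one_div_pow {ν : Measure ℝ} (h1 : ∀ᵐ t ∂ν, 1 ≤ t)
    (hν : Integrable (fun t : ℝ => 1 / t) ν) (n : ℕ) :
    Integrable (fun t : ℝ => 1 / t ^ (n + 1)) ν := by
  refine hν.mono' (by measurability) ?_
  filter_upwards [h1] with t ht
  have ht0 : 0 < t := by linarith
  rw [Real.norm_of_nonneg (by positivity)]
  exact one_div_le_one_div_of_le ht0 (le_self_pow₀ ht n.succ_ne_zero)

/-- Each of the n extra factors 1/t is at most 1/s. For s > 1 this is the geometric decay behind
compactness; s = 1 gives domination by the zeroth moment. -/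
theorem integral_one_div_pow_le {ν : Measure ℝ} {s : ℝ} (hs : 1 ≤ s) (h1 : ∀ᵐ t ∂ν, s ≤ t)
    (hν : Integrable (fun t : ℝ => 1 / t) ν) (n : ℕ) :
    ∫ t, 1 / t ^ (n + 1) ∂ν ≤ (∫ t, 1 / t ∂ν) * (1 / s) ^ n := by
  rw [← integral_mul_const]
  refine integral_mono_ae (integrable_one_div_pow (h1.mono fun t => hs.trans) hν n)
    (hν.mul_const _) ?_
  filter_upwards [h1] with t ht
  have hs0 : 0 < s := by linarith
  have ht0 : 0 < t := by linarith
  change 1 / t ^ (n + 1) ≤ 1 / t * (1 / s) ^ n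
  rw [pow_succ', ← one_div_mul_one_div, ← one_div_pow]
  gcongr

/-- Averages of dilations act on Taylor series as a moment multiplier. -/
theorem hasSum_moment_mul_taylorTerm {ν : Measure ℝ} (h1 : ∀ᵐ t ∂ν, 1 ≤ t)
    (hν : Integrable (fun t : ℝ => 1 / t) ν) {f : ℂ → ℂ} (hf : Differentiable ℂ f) (z : ℂ) :
    HasSum (fun n => ((∫ t, 1 / t ^ (n + 1) ∂ν : ℝ) : ℂ) * (taylorCoeff n f * z ^ n))
      (∫ t, (1 / (t : ℂ)) * f (z / t) ∂ν) := by
  let F : ℕ → ℝ → ℂ := fun n t => ((1 / t ^ (n + 1) : ℝ) : ℂ) * (taylorCoeff n f * z ^ n)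
  have hF : ∀ n, Integrable (F n) ν := fun n =>
    (integrable_one_div_pow h1 hν n).ofReal.mul_const _
  have hsum : Summable fun n => ∫ t, ‖F n t‖ ∂ν := by
    refine Summable.of_nonneg_of_le (fun n => integral_nonneg fun t => norm_nonneg _)
      (fun n => ?_) ((hasSum_taylorCoeff hf z).summable.norm.mul_left (∫ t, 1 / t ∂ν))
    have h2 : ∫ t, ‖F n t‖ ∂ν = (∫ t, 1 / t ^ (n + 1) ∂ν) * ‖taylorCoeff n f * z ^ n‖ := by
      rw [← integral_mul_const]
      refine integral_congr_ae ?_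
      filter_upwards [h1] with t ht
      have ht0 : 0 < t := by linarith
      simp only [F]
      rw [norm_mul, Complex.norm_real, Real.norm_of_nonneg (by positivity)]
    rw [h2]
    refine mul_le_mul_of_nonneg_right ?_ (norm_nonneg _)
    simpa only [div_one, one_pow, mul_one] using integral_one_div_pow_le le_rfl h1 hν n
  have h := hasSum_integral_of_summable_integral_norm hF hsum
  have heq : ∫ t, ∑' n, F n t ∂ν = ∫ t, (1 / (t : ℂ)) * f (z / t) ∂ν := by
    refine integral_congr_ae ?_
    filter_upwards [h1] with t ht
    have ht0 : (t : ℂ) ≠ 0 := by exact_mod_cast (by linarith : t ≠ 0)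
    refine HasSum.tsum_eq (((hasSum_taylorCoeff hf (z / t)).mul_left (1 / (t : ℂ))).congr_fun ?_)
    intro n
    simp only [F]
    push_cast
    rw [div_pow, pow_succ]
    field_simp
  rw [heq] at h
  refine h.congr_fun fun n => ?_
  simp only [F]
  rw [integral_mul_const, integral_complex_ofReal]

theorem differentiable_integral_dilation {ν : Measure ℝ} (h1 : ∀ᵐ t ∂ν, 1 ≤ t)
    (hν : Integrable (fun t : ℝ => 1 / t) ν) {f : ℂ → ℂ} (hf : Differentiable ℂ f) :
    Differentiable ℂ fun z => ∫ t, (1 / (t : ℂ)) * f (z / t) ∂ν := by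
  intro z
  have hz : z ∈ Metric.ball (0 : ℂ) (‖z‖ + 1) := by simp
  -- On the ball of radius ‖z‖ + 1 the multiplier series is dominated by its absolutely convergent
  -- values at the boundary point ‖z‖ + 1.
  have h := Complex.differentiableOn_tsum_of_summable_norm (U := Metric.ball (0 : ℂ) (‖z‖ + 1))
    (F := fun n z => ((∫ t, 1 / t ^ (n + 1) ∂ν : ℝ) : ℂ) * (taylorCoeff n f * z ^ n))
    (hasSum_moment_mul_taylorTerm h1 hν hf ((‖z‖ + 1 : ℝ) : ℂ)).summable.norm
    (fun n => by fun_prop) Metric.isOpen_ball fun n w hw => by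
      rw [norm_mul, norm_mul, norm_mul, norm_mul, norm_pow, norm_pow, Complex.norm_real (‖z‖ + 1),
        Real.norm_of_nonneg (by positivity : 0 ≤ ‖z‖ + 1)]
      gcongr
      simpa using (mem_ball_zero_iff.1 hw).le
  simp_rw [(hasSum_moment_mul_taylorTerm h1 hν hf _).tsum_eq] at h
  exact h.differentiableAt (Metric.isOpen_ball.mem_nhds hz)

/-- The averaging operator over dilations by factors in `[1, 2]` is bounded in the Fock norm by
the total mass. -/
theorem eLpNorm_fockMul_integral_dilation_le {p α : ℝ} (hp : 1 ≤ p) (hα : 0 < α)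
    {ν : Measure ℝ} [IsFiniteMeasure ν] (h12 : ∀ᵐ t ∂ν, t ∈ Icc (1 : ℝ) 2)
    {f : ℂ → ℂ} (hf : Differentiable ℂ f) :
    eLpNorm (fockMul α fun z => ∫ t, (1 / (t : ℂ)) * f (z / t) ∂ν) (ENNReal.ofReal p) volume ≤
      ν univ * (4 * eLpNorm (fockMul α f) (ENNReal.ofReal p) volume) := by
  have hm : Measurable (Function.uncurry fun (t : ℝ) (z : ℂ) =>
      fockMul α (fun z => (1 / (t : ℂ)) * f (z / t)) z) := by
    have hfm := hf.continuous.measurable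
    simp only [Function.uncurry_def, fockMul]
    fun_prop
  have h := eLpNorm_integral_le_of_forall_le (ν := ν) (ρ := (volume : Measure ℂ)) hp
    hm.aestronglyMeasurable (h12.mono fun t ht => eLpNorm_fockMul_dilation_le hp hα hf ht.1 ht.2)
  refine le_of_eq_of_le (congrArg (eLpNorm · _ _) ?_) h
  funext z
  simp only [fockMul]
  rw [integral_mul_const]

/-! ### Small and compact parts of the operator -/

namespace FockSpace

variable {p α : ℝ} [hp : Fact (1 ≤ p)]

theorem ext_apply {f g : FockSpace p α} (h : ∀ z, f z = g z) : f = g := coe_injective (funext h)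

variable [hα : Fact (0 < α)]

theorem exists_clm_integral_dilation {ν : Measure ℝ} [IsFiniteMeasure ν]
    (h12 : ∀ᵐ t ∂ν, t ∈ Icc (1 : ℝ) 2) :
    ∃ A : FockSpace p α →L[ℂ] FockSpace p α,
      (∀ f z, A f z = ∫ t, (1 / (t : ℂ)) * f (z / t) ∂ν) ∧ ‖A‖ ≤ ν.real univ * 4 := by
  have h1 : ∀ᵐ t ∂ν, 1 ≤ t := h12.mono fun t ht => ht.1
  have hν : Integrable (fun t : ℝ => 1 / t) ν := by
    refine (integrable_const (1 : ℝ)).mono' (by measurability) (h1.mono fun t ht => ?_)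
    rw [Real.norm_of_nonneg (by positivity), div_le_one (by linarith)]
    exact ht
  have hle := fun f : FockSpace p α =>
    eLpNorm_fockMul_integral_dilation_le hp.out hα.out h12 f.differentiable
  have hmass : ν univ * 4 = ENNReal.ofReal (ν.real univ * 4) := by
    rw [ENNReal.ofReal_mul measureReal_nonneg, ofReal_measureReal]
    norm_num
  refine ⟨LinearMap.mkContinuous
    { toFun := fun f => mk (fun z => ∫ t, (1 / (t : ℂ)) * f (z / t) ∂ν)
        (differentiable_integral_dilation h1 hν f.differentiable)
        ((hle f).trans_lt (ENNReal.mul_lt_top (measure_lt_top _ _)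
          (ENNReal.mul_lt_top (by norm_num) f.memLp.eLpNorm_lt_top)))
      map_add' := fun f g => ext_apply fun z => by
        change ∫ t, (1 / (t : ℂ)) * (f (z / t) + g (z / t)) ∂ν =
          (∫ t, (1 / (t : ℂ)) * f (z / t) ∂ν) + ∫ t, (1 / (t : ℂ)) * g (z / t) ∂ν
        simp_rw [mul_add]
        exact integral_add
          (integrable_one_div_mul_comp_div h1 hν f.differentiable.continuous z)
          (integrable_one_div_mul_comp_div h1 hν g.differentiable.continuous z)
      map_smul' := fun c f => ext_apply fun z => by
        change ∫ t, (1 / (t : ℂ)) * (c * f (z / t)) ∂ν = c * ∫ t, (1 / (t : ℂ)) * f (z / t) ∂ν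
        simp_rw [mul_left_comm _ c]
        exact integral_const_mul _ _ }
    (ν.real univ * 4) fun f => norm_le_mul_norm (by positivity) ?_,
    fun f z => rfl, LinearMap.mkContinuous_norm_le _ (by positivity) _⟩
  rw [← hmass, mul_assoc]
  exact hle f

/-- The moments decay like s^{-n} and the Taylor projections are contractions, so the multiplier
series converges in operator norm; its partial sums have finite rank. -/
theorem exists_compact_clm_integral_dilation {ν : Measure ℝ} {s : ℝ} (hs : 1 < s)
    (h1 : ∀ᵐ t ∂ν, s ≤ t) (hν : Integrable (fun t : ℝ => 1 / t) ν) :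
    ∃ B : FockSpace p α →L[ℂ] FockSpace p α,
      (∀ f z, B f z = ∫ t, (1 / (t : ℂ)) * f (z / t) ∂ν) ∧ IsCompactOperator B := by
  have h1' : ∀ᵐ t ∂ν, 1 ≤ t := h1.mono fun t => hs.le.trans
  let F : ℕ → FockSpace p α →L[ℂ] FockSpace p α := fun n =>
    ((∫ t, 1 / t ^ (n + 1) ∂ν : ℝ) : ℂ) • taylorProj n
  have hF : ∀ n, ‖F n‖ ≤ (∫ t, 1 / t ∂ν) * (1 / s) ^ n := fun n => by
    have h0 : 0 ≤ ∫ t, 1 / t ^ (n + 1) ∂ν := integral_nonneg_of_ae (h1'.mono fun t ht => by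
      have : 0 < t := by linarith
      change 0 ≤ 1 / t ^ (n + 1)
      positivity)
    rw [norm_smul, Complex.norm_real, Real.norm_of_nonneg h0]
    exact (mul_le_of_le_one_right h0 (taylorProj_norm_le n)).trans
      (integral_one_div_pow_le hs.le h1 hν n)
  have hsum : Summable F := Summable.of_norm_bounded
    ((summable_geometric_of_lt_one (by positivity)
      (by rw [div_lt_one (by linarith)]; exact hs)).mul_left _) hF
  refine ⟨∑' n, F n, fun f z => ?_, ?_⟩
  · have h := (hsum.hasSum.mapL (ContinuousLinearMap.apply ℂ (FockSpace p α) f)).mapL (evalCLM z)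
    exact h.unique (hasSum_moment_mul_taylorTerm h1' hν f.differentiable z)
  · refine isCompactOperator_of_tendsto hsum.hasSum (Eventually.of_forall fun S => ?_)
    refine Submodule.sum_mem (compactOperator (RingHom.id ℂ) (FockSpace p α) (FockSpace p α))
      fun n _ => ?_
    exact (isCompactOperator_taylorProj (p := p) (α := α) n).smul ((∫ t, 1 / t ^ (n + 1) ∂ν : ℝ) : ℂ)

/-- The dilations by factors close to `1` contribute an operator of small norm, the others a
compact operator. -/
theorem exists_decomposition {ν : Measure ℝ} (h1 : ∀ᵐ t ∂ν, 1 ≤ t)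
    (hν : Integrable (fun t : ℝ => 1 / t) ν) {s : ℝ} (hs : 1 < s) (hs2 : s ≤ 2) :
    ∃ A B : FockSpace p α →L[ℂ] FockSpace p α,
      (∀ f z, (A + B) f z = ∫ t, (1 / (t : ℂ)) * f (z / t) ∂ν) ∧ ‖A‖ ≤ ν.real (Iio s) * 4 ∧
        IsCompactOperator B := by
  have hfin : ν (Iio s) < ∞ := by
    -- Markov's inequality: 1/t is integrable and at least 1/s on t < s.
    have h2 := hν.measure_ge_lt_top (ε := 1 / s) (by positivity)
    refine lt_of_le_of_lt (measure_mono_ae ?_) h2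
    filter_upwards [h1] with t ht hts
    exact one_div_le_one_div_of_le (by linarith) (le_of_lt hts)
  have : IsFiniteMeasure (ν.restrict (Iio s)) := ⟨by rwa [Measure.restrict_apply_univ]⟩
  obtain ⟨A, hA, hAn⟩ := exists_clm_integral_dilation (p := p) (α := α) (ν := ν.restrict (Iio s)) (by
    filter_upwards [ae_restrict_of_ae h1, ae_restrict_mem measurableSet_Iio] with t ht hts
    exact ⟨ht, hts.le.trans hs2⟩)
  obtain ⟨B, hB, hBc⟩ := exists_compact_clm_integral_dilation (p := p) (α := α)
    (ν := ν.restrict (Ici s)) hs (ae_restrict_mem measurableSet_Ici) hν.integrableOn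
  refine ⟨A, B, fun f z => ?_, ?_, hBc⟩
  · have h : (A + B) f z = A f z + B f z := rfl
    rw [h, hA, hB, ← compl_Iio]
    exact integral_add_compl measurableSet_Iio
      (integrable_one_div_mul_comp_div h1 hν f.differentiable.continuous z)
  · rwa [measureReal_restrict_apply_univ] at hAn

theorem clm_ext_apply {A B : FockSpace p α →L[ℂ] FockSpace p α} (h : ∀ f z, A f z = B f z) :
    A = B := ContinuousLinearMap.ext fun f => ext_apply fun z => h f z

/-- As the cut decreases to 1, the mass below it tends to ν({1}) = 0. The noncompact remainder thus
vanishes in norm. -/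
theorem isCompactOperator_of_measure_singleton_eq_zero {ν : Measure ℝ} (h1 : ∀ᵐ t ∂ν, 1 ≤ t)
    (hν : Integrable (fun t : ℝ => 1 / t) ν) (h0 : ν {1} = 0)
    {T : FockSpace p α →L[ℂ] FockSpace p α}
    (hT : ∀ f z, T f z = ∫ t, (1 / (t : ℂ)) * f (z / t) ∂ν) : IsCompactOperator T := by
  let s : ℕ → ℝ := fun k => 1 + 1 / ((k : ℝ) + 1)
  have hs : ∀ k, 1 < s k := fun k => by
    have : 0 < 1 / ((k : ℝ) + 1) := by positivity
    simp only [s]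
    linarith
  have hs2 : ∀ k, s k ≤ 2 := fun k => by
    have : 1 / ((k : ℝ) + 1) ≤ 1 := by
      rw [div_le_one (by positivity)]
      have : (0 : ℝ) ≤ k := by positivity
      linarith
    simp only [s]
    linarith
  have hslim : Tendsto s atTop (𝓝 1) := by
    simpa only [s, add_zero] using
      (tendsto_one_div_add_atTop_nhds_zero_nat (𝕜 := ℝ)).const_add (1 : ℝ)
  choose A B hAB hA hB using fun k => exists_decomposition (p := p) (α := α) h1 hν (hs k) (hs2 k)
  have hsanti : Antitone fun k => Iio (s k) := fun k l hkl => Iio_subset_Iio (by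
    simp only [s]
    gcongr)
  have hmeas : Tendsto (fun k => ν (Iio (s k))) atTop (𝓝 0) := by
    have hfin : ν (Iio (s 0)) ≠ ∞ := by
      refine (lt_of_le_of_lt (measure_mono_ae ?_)
        (hν.measure_ge_lt_top (ε := 1 / s 0) (by have := hs 0; positivity))).ne
      filter_upwards [h1] with t ht hts
      exact one_div_le_one_div_of_le (by linarith) (le_of_lt hts)
    have h := tendsto_measure_iInter_atTop (μ := ν)
      (fun k => (measurableSet_Iio (a := s k)).nullMeasurableSet) hsanti ⟨0, hfin⟩
    have hzero : ν (⋂ k, Iio (s k)) = 0 := by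
      refine le_antisymm (le_of_le_of_eq (measure_mono_ae ?_) h0) zero_le
      filter_upwards [h1] with t ht hts
      exact le_antisymm (ge_of_tendsto' hslim fun k => (mem_iInter.1 hts k).le) ht
    rwa [hzero] at h
  have hA0 : Tendsto A atTop (𝓝 0) := by
    refine squeeze_zero_norm hA ?_
    have := (ENNReal.tendsto_toReal ENNReal.zero_ne_top).comp hmeas
    simpa [Measure.real, Function.comp_def] using this.mul_const 4
  have hBT : Tendsto B atTop (𝓝 T) := by
    have h2 : B = fun k => T - A k := funext fun k => by
      rw [eq_sub_iff_add_eq', clm_ext_apply fun f z => (hAB k f z).trans (hT f z).symm]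
    rw [h2]
    simpa using hA0.const_sub T
  exact isCompactOperator_of_tendsto hBT (Eventually.of_forall hB)

/-! ### Moments bounded below obstruct compactness -/

theorem taylorProj_monomial (n m : ℕ) : taylorProj n (monomial m : FockSpace p α) =
    if n = m then monomial n else 0 := by
  rw [taylorProj_apply, taylorCoeff_monomial]
  split_ifs <;> simp

/-- The multiplier sequence of a compact Taylor multiplier cannot stay away from zero. -/
theorem not_isCompactOperator_of_le {T : FockSpace p α →L[ℂ] FockSpace p α} {m : ℕ → ℝ} {c : ℝ}
    (hc : 0 < c) (hm : ∀ n, c ≤ m n)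
    (hT : ∀ n, T (monomial n) = (m n : ℂ) • (monomial n : FockSpace p α)) :
    ¬ IsCompactOperator T := by
  intro hcomp
  let e : ℕ → FockSpace p α := fun n => ((‖(monomial n : FockSpace p α)‖⁻¹ : ℝ) : ℂ) • monomial n
  have he : ∀ n, ‖e n‖ = 1 := fun n => by
    rw [norm_smul, Complex.norm_real, norm_inv, norm_norm,
      inv_mul_cancel₀ (monomial_norm_pos n).ne']
  have hTe : ∀ n, T (e n) = (m n : ℂ) • e n := fun n => by
    simp only [e]
    rw [map_smul, hT, smul_comm]
  obtain ⟨K, hK, hTK⟩ := IsCompactOperator.image_closedBall_subset_compact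
    (f := (T : FockSpace p α →ₗ[ℂ] FockSpace p α)) hcomp 1
  obtain ⟨x, _, φ, hφ, hx⟩ := hK.tendsto_subseq (x := fun n => T (e n)) fun n =>
    hTK ⟨e n, by simp [he], rfl⟩
  obtain ⟨N, hN⟩ := Metric.cauchySeq_iff.1 hx.cauchySeq c hc
  have hlt := hN N le_rfl (N + 1) N.le_succ
  have hne : φ N ≠ φ (N + 1) := (hφ N.lt_succ_self).ne
  -- Projecting to one of two distinct monomials kills the other; as the projection is a
  -- contraction, the two images are at distance at least `c`.
  have hproj : taylorProj (φ N) (T (e (φ N)) - T (e (φ (N + 1)))) = (m (φ N) : ℂ) • e (φ N) := by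
    rw [hTe, hTe, map_sub, map_smul, map_smul]
    simp only [e]
    rw [map_smul, map_smul, taylorProj_monomial, taylorProj_monomial, if_pos rfl, if_neg hne,
      smul_zero, smul_zero, sub_zero]
  have h := (taylorProj (φ N) : FockSpace p α →L[ℂ] FockSpace p α).le_of_opNorm_le
    (taylorProj_norm_le _) (T (e (φ N)) - T (e (φ (N + 1))))
  rw [hproj, norm_smul, he, mul_one, one_mul, Complex.norm_real, ← dist_eq_norm] at h
  exact absurd hlt (not_lt.2 ((hm _).trans ((le_abs_self _).trans h)))

end FockSpace

/-! ### The compactness criterion -/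

theorem tendsto_zero_of_antitone_of_forall_pos_not_le {m : ℕ → ℝ} (hanti : Antitone m)
    (hm0 : ∀ n, 0 ≤ m n) (h : ∀ c > 0, ¬ ∀ n, c ≤ m n) : Tendsto m atTop (𝓝 0) := by
  have hbdd : BddBelow (range m) := ⟨0, by rintro _ ⟨n, rfl⟩; exact hm0 n⟩
  have hlim := tendsto_atTop_ciInf hanti hbdd
  rcases (le_ciInf hm0).eq_or_lt with h0 | h0
  · rwa [← h0] at hlim
  · exact absurd (ciInf_le hbdd) (h _ h0)

theorem mainTheorem4 (p α : ℝ) [Fact (1 ≤ p)] [Fact (0 < α)] (hp : 1 < p)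
    (μ : Measure ℝ) (hμ : μ (Ioo 0 1) = 0) (hsup : (⨆ n : ℕ, hausdorffMoment μ n) < ∞) :
    (∀ (f : FockSpace p α) (z : ℂ),
      IntegrableOn (fun t : ℝ => (1 / (t : ℂ)) * f (z / (t : ℂ))) (Ioi 0) μ) ∧
    ∃ T : FockSpace p α →L[ℂ] FockSpace p α,
      (∀ (f : FockSpace p α) (z : ℂ), (T f) z = hausdorffOp μ f z) ∧
      (IsCompactOperator T ↔ Tendsto (fun n : ℕ => hausdorffMoment μ n) atTop (𝓝 0)) := by
  have hμ1 : (μ.restrict (Ioi 0)) = μ.restrict (Ici 1) := by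
    refine Measure.restrict_congr_set ?_
    have h : ∀ᵐ t ∂μ, t ∉ Ioo (0 : ℝ) 1 := measure_eq_zero_iff_ae_notMem.1 hμ
    filter_upwards [h] with t ht
    refine propext ⟨fun h0 => not_lt.1 fun h1 => ht ⟨h0, h1⟩, fun h1 => ?_⟩
    exact lt_of_lt_of_le one_pos (show (1 : ℝ) ≤ t from h1)
  set ν := μ.restrict (Ici (1 : ℝ)) with hνdef
  have h1 : ∀ᵐ t ∂ν, 1 ≤ t := ae_restrict_mem measurableSet_Ici
  have hν : Integrable (fun t : ℝ => 1 / t) ν := by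
    -- The zeroth moment is the integral of 1/t and dominates all the others.
    have hm0 := (le_iSup (hausdorffMoment μ) 0).trans_lt hsup
    refine ⟨by measurability, ?_⟩
    rw [hasFiniteIntegral_iff_ofReal (h1.mono fun t ht => by
      change 0 ≤ 1 / t
      positivity)]
    simpa [hausdorffMoment] using hm0
  have hmom : ∀ n, hausdorffMoment μ n = ENNReal.ofReal (∫ t, 1 / t ^ (n + 1) ∂ν) := fun n =>
    (ofReal_integral_eq_lintegral_ofReal (integrable_one_div_pow h1 hν n) (h1.mono fun t ht => by
      change 0 ≤ 1 / t ^ (n + 1)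
      positivity)).symm
  refine ⟨fun f z => ?_, ?_⟩
  · rw [IntegrableOn, hμ1]
    exact integrable_one_div_mul_comp_div h1 hν f.differentiable.continuous z
  -- For boundedness a single cut suffices, here at s = 2.
  obtain ⟨A, B, hAB, -, -⟩ :=
    FockSpace.exists_decomposition (p := p) (α := α) h1 hν one_lt_two le_rfl
  refine ⟨A + B, fun f z => ?_, fun hcomp => ?_, fun hlim => ?_⟩
  · rw [hAB, hausdorffOp, hμ1]
  · have hT : ∀ n, (A + B) (FockSpace.monomial n) =
        ((∫ t, 1 / t ^ (n + 1) ∂ν : ℝ) : ℂ) • (FockSpace.monomial n : FockSpace p α) := by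
      refine fun n => FockSpace.ext_apply fun z => ?_
      rw [hAB]
      change ∫ t, (1 / (t : ℂ)) * (z / t) ^ n ∂ν = ((∫ t, 1 / t ^ (n + 1) ∂ν : ℝ) : ℂ) * z ^ n
      rw [← integral_complex_ofReal, ← integral_mul_const]
      refine integral_congr_ae (ae_of_all _ fun t => ?_)
      change (1 / (t : ℂ)) * (z / t) ^ n = ((1 / t ^ (n + 1) : ℝ) : ℂ) * z ^ n
      push_cast
      rw [div_pow, pow_succ']
      ring
    have hlim := tendsto_zero_of_antitone_of_forall_pos_not_le
      (m := fun n => ∫ t, 1 / t ^ (n + 1) ∂ν)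
      (antitone_nat_of_succ_le fun n => integral_mono_ae (integrable_one_div_pow h1 hν _)
        (integrable_one_div_pow h1 hν _) (h1.mono fun t ht => one_div_le_one_div_of_le
          (by positivity) (pow_le_pow_right₀ ht (Nat.le_succ _))))
      (fun n => integral_nonneg_of_ae (h1.mono fun t ht => by
        change 0 ≤ 1 / t ^ (n + 1)
        positivity))
      fun c hc hle => FockSpace.not_isCompactOperator_of_le hc hle hT hcomp
    simpa [hmom] using ENNReal.tendsto_ofReal hlim
  · refine FockSpace.isCompactOperator_of_measure_singleton_eq_zero h1 hν ?_ hAB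
    refine le_antisymm (ge_of_tendsto' hlim fun n => ?_) zero_le
    -- At t = 1 every moment integrand equals 1, so each moment bounds the atom.
    calc ν {1} = ∫⁻ t in {1}, ENNReal.ofReal (1 / t ^ (n + 1)) ∂ν := by simp
      _ ≤ hausdorffMoment μ n := setLIntegral_le_lintegral _ _
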